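/- \textbf{Notation.} For a real random variable $X$ let $\|X\|_{\psi_2}=\sup_{k\ge 1}k^{-1/2}\{\mathbb E(|X|^k)\}^{1/k}$ (supremum over integers $k\ge1$). \textbf{Model.} Let $n\ge 3$ and $\sigma,\kappa,\Delta>0$. Let $Y_1,\dots,Y_n$ be independent real random variables with $\mathbb E(Y_i)=f_i$ and $\|Y_i-f_i\|_{\psi_2}\le\sigma$ for all $i$. Let $K\ge 0$ and let $0=\eta_0<\eta_1<\dots<\eta_K<\eta_{K+1}=n$ be integers such that $f_{\eta_k+1}=\dots=f_{\eta_{k+1}}$ for $k=0,\dots,K$. Assume that $\eta_k-\eta_{k-1}\ge\Delta$ for $k=1,\dots,K+1$ and that $\kappa_k:=|f_{\eta_k+1}-f_{\eta_k}|\ge\kappa$ for $k=1,\dots,K$. \textbf{Estimator.} For $\lambda>0$ let $\widehat u(\lambda)$ be a minimizer over $u\in\mathbb R^n$ of \[H(u)=\sum_{i=1}^n (Y_i-u_i)^2+\lambda\,\#\{i\in\{1,\dots,n-1\}:u_i\ne u_{i+1}\},\] and let $\widehat\eta_1(\lambda)<\dots<\widehat\eta_{\widehat K(\lambda)}(\lambda)$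 be the elements of $\{i\in\{1,\dots,n-1\}:\widehat u_i(\lambda)\ne\widehat u_{i+1}(\lambda)\}$. \textbf{Theorem.} For every $c>3$ there are constants $C_\lambda,C_{\mathrm{SNR}},C_\epsilon>0$, depending only on $c$, such that the following holds for every instance of the model above and every $\xi>0$. If \[\kappa\sqrt\Delta/\sigma\ \ge\ C_{\mathrm{SNR}}\sqrt{\log^{1+\xi}(n)}\] and $\lambda=C_\lambda\sigma^2\log(n)$, then with probability at least $1-e\cdot n^{3-c}$ the functional $H$ has a minimizer, and every minimizer $\widehat u(\lambda)$ satisfies \[\widehat K(\lambda)=K\quad\text{and}\quad |\widehat\eta_k(\lambda)-\eta_k|\le C_\epsilon\,\sigma^2\log(n)/\kappa_k^2\quad\text{for all }k\in\{1,\dots,K\}.\] -/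

import Mathlib

open MeasureTheory ProbabilityTheory

namespace ChangePoint

/-- The Orlicz `ψ₂` (sub-Gaussian) norm of a random variable in its moment form,
`sup_{k ≥ 1} k^{-1/2} (𝔼 |X|^k)^{1/k}`, with values in `[0, ∞]`. -/
noncomputable def psi2Norm {Ω : Type*} [MeasurableSpace Ω] (X : Ω → ℝ) (μ : Measure Ω) :
    ENNReal :=
  ⨆ (k : ℕ) (_ : 1 ≤ k), eLpNorm X (k : ENNReal) μ / ENNReal.ofReal (Real.sqrt (k : ℝ))

/-- The jump size `κ_k = |f_{η_k + 1} - f_{η_k}|` of the mean vector at the change point `η_k`. -/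
def jumpSize (f : ℕ → ℝ) (η : ℕ → ℕ) (k : ℕ) : ℝ :=
  |f (η k + 1) - f (η k)|

/-- The change point model. Sequences are indexed as in `Y_1, …, Y_n` and `η_0, …, η_{K+1}`: only
the indices `1 ≤ i ≤ n` of `Y`, `f` and `0 ≤ k ≤ K + 1` of `η` matter.
The observations are independent with means `f_i` and fluctuations bounded by `σ` in `ψ₂`-norm,
the mean is constant on each `(η_k, η_{k+1}]`, consecutive change points are at least `Δ` apart, and
each jump is at least `κ` in absolute value. -/
structure Model {Ω : Type*} [MeasurableSpace Ω] (μ : Measure Ω) (n K : ℕ)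
    (Y : ℕ → Ω → ℝ) (f : ℕ → ℝ) (η : ℕ → ℕ) (σ κ Δ : ℝ) : Prop where
  measurable : ∀ i ∈ Finset.Icc 1 n, Measurable (Y i)
  indep : iIndepFun (fun i : Finset.Icc 1 n => Y i) μ
  mean : ∀ i ∈ Finset.Icc 1 n, ∫ ω, Y i ω ∂μ = f i
  sigma_pos : 0 < σ
  subGaussian : ∀ i ∈ Finset.Icc 1 n, psi2Norm (fun ω => Y i ω - f i) μ ≤ ENNReal.ofReal σ
  eta_zero : η 0 = 0
  eta_last : η (K + 1) = n
  eta_lt : ∀ k ≤ K, η k < η (k + 1)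
  mean_const : ∀ k ≤ K, ∀ i ∈ Finset.Ioc (η k) (η (k + 1)), f i = f (η (k + 1))
  spacing_pos : 0 < Δ
  spacing_le : ∀ k ≤ K, Δ ≤ (η (k + 1) : ℝ) - (η k : ℝ)
  jump_pos : 0 < κ
  jump_le : ∀ k ∈ Finset.Icc 1 K, κ ≤ jumpSize f η k

/-- The change points `{i ∈ {1, …, n - 1} : u_i ≠ u_{i+1}}` induced by a vector
`u = (u_1, …, u_n)`; the other values of `u` are ignored. -/
noncomputable def inducedChangePoints (n : ℕ) (u : ℕ → ℝ) : Finset ℕ :=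
  {i ∈ Finset.Ico 1 n | u i ≠ u (i + 1)}

/-- The Potts functional `H(u, y, lam) = ∑_{i=1}^n (y_i - u_i)² + lam ‖Du‖₀`. -/
noncomputable def pottsObjective (n : ℕ) (y : ℕ → ℝ) (lam : ℝ) (u : ℕ → ℝ) : ℝ :=
  ∑ i ∈ Finset.Icc 1 n, (y i - u i) ^ 2 + lam * ((inducedChangePoints n u).card : ℝ)

/-- `u` is an `ℓ₀`-penalized least squares (Potts) estimator: a global minimizer of `H`. -/
def IsPottsEstimator (n : ℕ) (y : ℕ → ℝ) (lam : ℝ) (u : ℕ → ℝ) : Prop :=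
  ∀ v : ℕ → ℝ, pottsObjective n y lam u ≤ pottsObjective n y lam v

/-- The vector `u` induces exactly `K` change points, and its `k`-th smallest one is within
`C σ² log n / κ_k²` of `η_k` for every `k = 1, …, K`. -/
def Localizes (n K : ℕ) (f : ℕ → ℝ) (η : ℕ → ℕ) (σ C : ℝ) (u : ℕ → ℝ) : Prop :=
  ∃ hK : (inducedChangePoints n u).card = K, ∀ k : Fin K,
    |(((inducedChangePoints n u).orderEmbOfFin hK k : ℕ) : ℝ) - (η ((k : ℕ) + 1) : ℝ)| ≤
      C * σ ^ 2 * Real.log n / jumpSize f η ((k : ℕ) + 1) ^ 2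

end ChangePoint

/-!
Replace the estimator `u` by another vector `g` on an interval `(a, b]`. Since `u` is a minimizer,
the change in residual sum of squares (`rssChange`) is at least the penalty times the number of
change points removed minus the number created (`IsPottsEstimator.card_mul_le`). Everything
deterministic follows from this inequality for well chosen `a`, `b`, `g`.

*Noise.* A `ψ₂`-bound gives a sub-Gaussian moment generating function
(`hasSubgaussianMGF_of_psi2Norm_le`), so with probability at least `1 - e n ^ (3 - c)` all partial
sums of the noise over intervals `(s, t]` are at most `√(L (t - s))` with `L = 56 c σ² log n`
(`Model.exists_noise_event`). On this event refitting a piece of `u` by the true mean costs at most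
`L` (`NoiseBound.rssChange_le_cpCount`), whereas the penalty is `20 L`.

*Every true change point is found* (`StrongSignal.exists_near`). If `u` had no change point within
`256 L / κ_k²` of `η_k`, it would be constant across the jump, and three additional change points
would pay off. This already is the localization bound.

*Nothing else is found* (`StrongSignal.cpCount_le_one`). Let `a` be the last estimated change point
near `η_k` and `b` the first one near `η_{k+2}`. Take for `g` on `(a, b]` the step function that
jumps at `η_{k+1}` only, with the true means. If there were two or more estimated change points in
between, `g` would save more in penalty than it costs. The delicate part is the edge between `a`
and `η_k` (if `a < η_k`), where the mean differs from `g`. There `u` takes the same value as on a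
stretch of length at least `25000000 L / κ_k²` beyond `η_k`, so it is already very close to `g`,
and since the edge is no longer than `256 L / κ_k²`, the extra cost is at most `2 L`
(`IsPottsEstimator.rssChange_edge_le`). Counting then identifies the estimated change points with
the true ones in order (`StrongSignal.exists_orderEmbOfFin`).

*Existence.* The functional is lower semicontinuous, and clamping a vector to a box containing the
data does not increase it (`exists_isPottsEstimator`).
-/

open MeasureTheory ProbabilityTheory

namespace ChangePoint

/-! ### From the `ψ₂` norm to a sub-Gaussian moment generating function -/

theorem exp_le_add_exp_sq (x : ℝ) : Real.exp x ≤ x + Real.exp (x ^ 2) := by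
  have h1 := Real.add_one_le_exp (x ^ 2)
  rcases le_or_gt |x| 1 with h | h
  · have := (abs_le.1 (Real.abs_exp_sub_one_sub_id_le h)).2
    linarith
  · rcases lt_abs.1 h with h | h
    · have : Real.exp x ≤ Real.exp (x ^ 2) := Real.exp_le_exp.2 (by nlinarith)
      linarith
    · have : Real.exp x ≤ 1 := Real.exp_le_one_iff.2 (by linarith)
      nlinarith

section PsiTwo

variable {Ω : Type*} [MeasurableSpace Ω] {μ : Measure Ω} {X : Ω → ℝ} {σ : ℝ}

theorem eLpNorm_le_of_psi2Norm_le (h : psi2Norm X μ ≤ ENNReal.ofReal σ) {k : ℕ} (hk : 1 ≤ k) :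
    eLpNorm X (k : ENNReal) μ ≤ ENNReal.ofReal σ * ENNReal.ofReal (Real.sqrt k) := by
  have h1 : eLpNorm X (k : ENNReal) μ / ENNReal.ofReal (Real.sqrt (k : ℝ)) ≤ ENNReal.ofReal σ :=
    le_trans (le_iSup₂_of_le k hk le_rfl) h
  have hpos : 0 < Real.sqrt (k : ℝ) := Real.sqrt_pos.2 (by exact_mod_cast hk)
  rwa [ENNReal.div_le_iff (by simpa using hpos) ENNReal.ofReal_ne_top] at h1

theorem lintegral_pow_le_of_psi2Norm_le (hσ : 0 ≤ σ) (h : psi2Norm X μ ≤ ENNReal.ofReal σ)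
    {k : ℕ} (hk : 1 ≤ k) :
    ∫⁻ ω, ENNReal.ofReal ((X ω ^ 2) ^ k) ∂μ ≤ ENNReal.ofReal ((2 * σ ^ 2 * k) ^ k) := by
  have h1 := eLpNorm_le_of_psi2Norm_le h (k := 2 * k) (by omega)
  have h2 := eLpNorm_nnreal_pow_eq_lintegral (μ := μ) (f := X) (p := ((2 * k : ℕ) : NNReal))
    (by positivity)
  have h3 : ∫⁻ ω, ENNReal.ofReal ((X ω ^ 2) ^ k) ∂μ =
      eLpNorm X ((2 * k : ℕ) : ENNReal) μ ^ (2 * k) := by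
    have h4 : ((((2 * k : ℕ) : NNReal) : ENNReal)) = ((2 * k : ℕ) : ENNReal) := by norm_cast
    have h5 : ((((2 * k : ℕ) : NNReal) : ℝ)) = ((2 * k : ℕ) : ℝ) := by norm_cast
    rw [h4, h5, ENNReal.rpow_natCast] at h2
    rw [h2]
    refine lintegral_congr fun ω => ?_
    rw [ENNReal.rpow_natCast, Real.enorm_eq_ofReal_abs, ← ENNReal.ofReal_pow (abs_nonneg _),
      pow_mul, sq_abs]
  rw [h3]
  refine (pow_le_pow_left' h1 _).trans (le_of_eq ?_)
  rw [← ENNReal.ofReal_mul hσ, ← ENNReal.ofReal_pow (by positivity), pow_mul, mul_pow,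
    Real.sq_sqrt (by positivity)]
  push_cast
  ring_nf

/-- The moment bound `𝔼 X^{2k} ≤ (2kσ²)^k` and `k^k ≤ e^k k!` dominate the exponential series of
`exp (s X²)` by a geometric series. -/
theorem lintegral_exp_sq_le [IsProbabilityMeasure μ] (hX : Measurable X) (hσ : 0 ≤ σ)
    (h : psi2Norm X μ ≤ ENNReal.ofReal σ) {s : ℝ} (hs : 0 ≤ s)
    (hq : 2 * Real.exp 1 * σ ^ 2 * s < 1) :
    ∫⁻ ω, ENNReal.ofReal (Real.exp (s * X ω ^ 2)) ∂μ ≤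
      ENNReal.ofReal (1 - 2 * Real.exp 1 * σ ^ 2 * s)⁻¹ := by
  set q := 2 * Real.exp 1 * σ ^ 2 * s with hqdef
  have hq0 : 0 ≤ q := by positivity
  have hexp : ∀ x : ℝ, 0 ≤ x →
      ENNReal.ofReal (Real.exp x) = ∑' k : ℕ, ENNReal.ofReal (x ^ k / k.factorial) := by
    intro x hx
    rw [Real.exp_eq_exp_ℝ, NormedSpace.exp_eq_tsum_div,
      ENNReal.ofReal_tsum_of_nonneg (fun k => by positivity) (Real.summable_pow_div_factorial x)]
  have hterm : ∀ k : ℕ,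
      ∫⁻ ω, ENNReal.ofReal ((s * X ω ^ 2) ^ k / k.factorial) ∂μ ≤ ENNReal.ofReal (q ^ k) := by
    intro k
    rcases Nat.eq_zero_or_pos k with rfl | hk
    · simp
    have e1 : ∀ ω, ENNReal.ofReal ((s * X ω ^ 2) ^ k / k.factorial) =
        ENNReal.ofReal (s ^ k / k.factorial) * ENNReal.ofReal ((X ω ^ 2) ^ k) := by
      intro ω
      rw [← ENNReal.ofReal_mul (by positivity), mul_pow]
      ring_nf
    simp_rw [e1]
    rw [lintegral_const_mul _ (by fun_prop)]
    refine (mul_le_mul_right (lintegral_pow_le_of_psi2Norm_le hσ h hk) _).trans ?_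
    rw [← ENNReal.ofReal_mul (by positivity)]
    refine ENNReal.ofReal_le_ofReal ?_
    have h6 := Real.pow_div_factorial_le_exp (k : ℝ) (by positivity) k
    have h7 : Real.exp (k : ℝ) = Real.exp 1 ^ k := by rw [← Real.exp_nat_mul]; simp
    calc s ^ k / k.factorial * (2 * σ ^ 2 * k) ^ k
        = (2 * σ ^ 2 * s) ^ k * ((k : ℝ) ^ k / k.factorial) := by
          simp only [mul_pow]; ring
      _ ≤ (2 * σ ^ 2 * s) ^ k * Real.exp 1 ^ k := by
          rw [← h7]; gcongr
      _ = q ^ k := by rw [← mul_pow, hqdef]; ring_nf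
  calc ∫⁻ ω, ENNReal.ofReal (Real.exp (s * X ω ^ 2)) ∂μ
      = ∫⁻ ω, ∑' k : ℕ, ENNReal.ofReal ((s * X ω ^ 2) ^ k / k.factorial) ∂μ :=
        lintegral_congr fun ω => hexp _ (by positivity)
    _ = ∑' k : ℕ, ∫⁻ ω, ENNReal.ofReal ((s * X ω ^ 2) ^ k / k.factorial) ∂μ :=
        lintegral_tsum fun k => by fun_prop
    _ ≤ ∑' k : ℕ, ENNReal.ofReal (q ^ k) := ENNReal.tsum_le_tsum hterm
    _ = ENNReal.ofReal (1 - q)⁻¹ := by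
        rw [← tsum_geometric_of_lt_one hq0 hq, ENNReal.ofReal_tsum_of_nonneg
          (fun k => by positivity) (summable_geometric_of_lt_one hq0 hq)]

theorem integrable_exp_sq [IsProbabilityMeasure μ] (hX : Measurable X) (hσ : 0 ≤ σ)
    (h : psi2Norm X μ ≤ ENNReal.ofReal σ) {s : ℝ} (hs : 0 ≤ s)
    (hq : 2 * Real.exp 1 * σ ^ 2 * s < 1) :
    Integrable (fun ω => Real.exp (s * X ω ^ 2)) μ ∧
      ∫ ω, Real.exp (s * X ω ^ 2) ∂μ ≤ (1 - 2 * Real.exp 1 * σ ^ 2 * s)⁻¹ := by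
  have hle := lintegral_exp_sq_le hX hσ h hs hq
  have hm : AEStronglyMeasurable (fun ω => Real.exp (s * X ω ^ 2)) μ := by fun_prop
  have hnn : 0 ≤ᵐ[μ] fun ω => Real.exp (s * X ω ^ 2) := ae_of_all _ fun ω => by positivity
  refine ⟨⟨hm, (hasFiniteIntegral_iff_ofReal hnn).2 (hle.trans_lt ENNReal.ofReal_lt_top)⟩, ?_⟩
  rw [integral_eq_lintegral_of_nonneg_ae hnn hm]
  exact ENNReal.toReal_le_of_le_ofReal (inv_nonneg.2 (by linarith)) hle

/-- For small `t` the bound comes from `exp (tX) ≤ tX + exp (t²X²)`, whose linear term has mean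
zero; for large `t` from Young's inequality `tX ≤ e σ² t² + X² / (4 e σ²)`. Both give `𝔼 exp (tX) ≤ exp (5 e σ² t²)`,
and `10 e ≤ 28`. -/
theorem hasSubgaussianMGF_of_psi2Norm_le [IsProbabilityMeasure μ] (hX : Measurable X) (hσ : 0 < σ)
    (h : psi2Norm X μ ≤ ENNReal.ofReal σ) (hint : Integrable X μ) (hmean : ∫ ω, X ω ∂μ = 0) :
    HasSubgaussianMGF X (Real.toNNReal (28 * σ ^ 2)) μ := by
  have he : Real.exp 1 < 2.7182818286 := Real.exp_one_lt_d9
  have he0 : 0 < Real.exp 1 := Real.exp_pos 1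
  have hyoung : ∀ t ω, t * X ω ≤
      Real.exp 1 * σ ^ 2 * t ^ 2 + (4 * Real.exp 1 * σ ^ 2)⁻¹ * X ω ^ 2 := by
    intro t ω
    have hp : 0 < 4 * Real.exp 1 * σ ^ 2 := by positivity
    have : Real.exp 1 * σ ^ 2 * t ^ 2 + (4 * Real.exp 1 * σ ^ 2)⁻¹ * X ω ^ 2 - t * X ω =
        (4 * Real.exp 1 * σ ^ 2)⁻¹ * (2 * Real.exp 1 * σ ^ 2 * t - X ω) ^ 2 := by
      field_simp
      ring
    have h2 : 0 ≤ (4 * Real.exp 1 * σ ^ 2)⁻¹ * (2 * Real.exp 1 * σ ^ 2 * t - X ω) ^ 2 := by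
      positivity
    linarith
  have hhalf : 2 * Real.exp 1 * σ ^ 2 * (4 * Real.exp 1 * σ ^ 2)⁻¹ = 1 / 2 := by
    field_simp; norm_num
  obtain ⟨hi, hb⟩ := integrable_exp_sq hX hσ.le h (s := (4 * Real.exp 1 * σ ^ 2)⁻¹)
    (by positivity) (by rw [hhalf]; norm_num)
  rw [hhalf] at hb
  have hdom : ∀ t ω, Real.exp (t * X ω) ≤
      Real.exp (Real.exp 1 * σ ^ 2 * t ^ 2) *
        Real.exp ((4 * Real.exp 1 * σ ^ 2)⁻¹ * X ω ^ 2) := by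
    intro t ω
    rw [← Real.exp_add]
    exact Real.exp_le_exp.2 (hyoung t ω)
  have hint_exp : ∀ t, Integrable (fun ω => Real.exp (t * X ω)) μ := fun t =>
    (hi.const_mul (Real.exp (Real.exp 1 * σ ^ 2 * t ^ 2))).mono' (by fun_prop)
      (ae_of_all _ fun ω => by
        rw [Real.norm_of_nonneg (Real.exp_pos _).le]; exact hdom t ω)
  refine ⟨hint_exp, fun t => ?_⟩
  have hc : ((Real.toNNReal (28 * σ ^ 2) : NNReal) : ℝ) = 28 * σ ^ 2 :=
    Real.coe_toNNReal _ (by positivity)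
  rw [hc, mgf]
  have hst : 0 ≤ σ ^ 2 * t ^ 2 := by positivity
  set q := 2 * Real.exp 1 * σ ^ 2 * t ^ 2 with hqdef
  have hq0 : 0 ≤ q := by positivity
  rcases le_or_gt q (1 / 2) with hq | hq
  · obtain ⟨hi2, hb2⟩ := integrable_exp_sq hX hσ.le h (s := t ^ 2) (by positivity)
      (by rw [← hqdef]; linarith)
    rw [← hqdef] at hb2
    calc ∫ ω, Real.exp (t * X ω) ∂μ
        ≤ ∫ ω, (t * X ω + Real.exp (t ^ 2 * X ω ^ 2)) ∂μ :=
          integral_mono (hint_exp t) ((hint.const_mul t).add hi2) fun ω => by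
            have := exp_le_add_exp_sq (t * X ω)
            rwa [mul_pow] at this
      _ = ∫ ω, Real.exp (t ^ 2 * X ω ^ 2) ∂μ := by
          rw [integral_add (hint.const_mul t) hi2, integral_const_mul, hmean]; simp
      _ ≤ (1 - q)⁻¹ := hb2
      _ ≤ 2 * q + 1 := by
          rw [inv_le_iff_one_le_mul₀ (by linarith)]; nlinarith
      _ ≤ Real.exp (2 * q) := Real.add_one_le_exp _
      _ ≤ Real.exp (28 * σ ^ 2 * t ^ 2 / 2) := by
          refine Real.exp_le_exp.2 ?_
          rw [hqdef]; nlinarith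
  · calc ∫ ω, Real.exp (t * X ω) ∂μ
        ≤ ∫ ω, Real.exp (Real.exp 1 * σ ^ 2 * t ^ 2) *
            Real.exp ((4 * Real.exp 1 * σ ^ 2)⁻¹ * X ω ^ 2) ∂μ :=
          integral_mono (hint_exp t) (hi.const_mul _) fun ω => hdom t ω
      _ ≤ Real.exp (Real.exp 1 * σ ^ 2 * t ^ 2) * 2 := by
          rw [integral_const_mul]
          gcongr
          exact hb.trans (by norm_num)
      _ ≤ Real.exp (Real.exp 1 * σ ^ 2 * t ^ 2) * Real.exp (2 * q) := by
          gcongr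
          have := Real.add_one_le_exp (2 * q)
          linarith
      _ ≤ Real.exp (28 * σ ^ 2 * t ^ 2 / 2) := by
          rw [← Real.exp_add]
          refine Real.exp_le_exp.2 ?_
          rw [hqdef]; nlinarith

end PsiTwo

/-! ### Uniform control of the partial sums of the noise -/

section Noise

variable {Ω : Type*} [MeasurableSpace Ω] {μ : Measure Ω} [IsProbabilityMeasure μ] {n K : ℕ}
  {Y : ℕ → Ω → ℝ} {f : ℕ → ℝ} {η : ℕ → ℕ} {σ κ Δ : ℝ}

theorem Model.hasSubgaussianMGF (hM : Model μ n K Y f η σ κ Δ) {i : ℕ} (hi : i ∈ Finset.Icc 1 n) :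
    HasSubgaussianMGF (fun ω => Y i ω - f i) (Real.toNNReal (28 * σ ^ 2)) μ := by
  have hmeas : Measurable fun ω => Y i ω - f i := (hM.measurable i hi).sub_const _
  have hint : Integrable (fun ω => Y i ω - f i) μ := by
    refine memLp_one_iff_integrable.1 ⟨hmeas.aestronglyMeasurable, ?_⟩
    have := eLpNorm_le_of_psi2Norm_le (hM.subGaussian i hi) le_rfl
    rw [Nat.cast_one] at this
    exact this.trans_lt (ENNReal.mul_lt_top ENNReal.ofReal_lt_top ENNReal.ofReal_lt_top)
  have hintY : Integrable (Y i) μ :=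
    (hint.add (integrable_const (f i))).congr (ae_of_all _ fun ω => by simp)
  refine hasSubgaussianMGF_of_psi2Norm_le hmeas hM.sigma_pos (hM.subGaussian i hi) hint ?_
  rw [integral_sub hintY (integrable_const _), hM.mean i hi]
  simp

/-- Two-sided Hoeffding bound for the noise on `(s, t]`. -/
theorem Model.measureReal_noise_sum_sq_gt_le (hM : Model μ n K Y f η σ κ Δ) (hn : 3 ≤ n)
    {c : ℝ} (hc : 0 < c) {s t : ℕ} (hst : s < t) (ht : t ≤ n) :
    μ.real {ω | 56 * c * σ ^ 2 * Real.log n * ((t : ℝ) - s) <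
      (∑ i ∈ Finset.Ioc s t, (Y i ω - f i)) ^ 2} ≤ 2 * (n : ℝ) ^ (-c) := by
  have hn0 : (0 : ℝ) < n := by exact_mod_cast (show 0 < n by omega)
  have hlog : 0 < Real.log n := Real.log_pos (by exact_mod_cast (show 1 < n by omega))
  have hσ := hM.sigma_pos
  have hm : (0 : ℝ) < (t : ℝ) - s := sub_pos.2 (by exact_mod_cast hst)
  set m : ℝ := (t : ℝ) - s with hmdef
  set E := 56 * c * σ ^ 2 * Real.log n * m with hE
  have hE0 : 0 ≤ E := by positivity
  have hmem : ∀ i ∈ Finset.Ioc s t, i ∈ Finset.Icc 1 n := by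
    intro i hi
    simp only [Finset.mem_Ioc, Finset.mem_Icc] at *
    omega
  let X : Finset.Icc 1 n → Ω → ℝ := fun i ω => Y i ω - f i
  have hind : iIndepFun X μ :=
    hM.indep.comp (g := fun i x => x - f i) (fun i => measurable_id.sub_const _)
  have hindneg : iIndepFun (fun i => -X i) μ :=
    hind.comp (g := fun _ x => -x) (fun i => measurable_neg)
  let S := (Finset.Ioc s t).subtype (· ∈ Finset.Icc 1 n)
  have hsum : ∀ ω, ∑ i ∈ S, X i ω = ∑ i ∈ Finset.Ioc s t, (Y i ω - f i) := fun ω =>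
    Finset.sum_subtype_of_mem (fun i => Y i ω - f i) hmem
  have hcard : (S.card : ℝ) = m := by
    have h1 : S.card = (Finset.Ioc s t).card := by
      have := Finset.sum_subtype_of_mem (s := Finset.Ioc s t) (fun _ => 1) hmem
      simpa [S] using this
    rw [h1, Nat.card_Ioc, Nat.cast_sub hst.le]
  have hcs : ((Real.toNNReal (28 * σ ^ 2) : NNReal) : ℝ) = 28 * σ ^ 2 :=
    Real.coe_toNNReal _ (by positivity)
  have hsub : ∀ i ∈ S, HasSubgaussianMGF (X i) (Real.toNNReal (28 * σ ^ 2)) μ := fun i _ =>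
    hM.hasSubgaussianMGF i.2
  have hval : Real.exp (-(Real.sqrt E) ^ 2 /
      (2 * ((∑ _i ∈ S, Real.toNNReal (28 * σ ^ 2) : NNReal) : ℝ))) = (n : ℝ) ^ (-c) := by
    rw [Finset.sum_const, nsmul_eq_mul, NNReal.coe_mul, NNReal.coe_natCast, hcard, hcs,
      Real.sq_sqrt hE0, Real.rpow_def_of_pos hn0, hE]
    congr 1
    field_simp
    norm_num
  have h1 := HasSubgaussianMGF.measure_sum_ge_le_of_iIndepFun hind hsub (Real.sqrt_nonneg E)
  have h2 := HasSubgaussianMGF.measure_sum_ge_le_of_iIndepFun hindneg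
    (fun i hi => (hsub i hi).neg) (Real.sqrt_nonneg E)
  push_cast at hval h1 h2
  rw [hval] at h1 h2
  have hsubset : {ω | E < (∑ i ∈ Finset.Ioc s t, (Y i ω - f i)) ^ 2} ⊆
      {ω | Real.sqrt E ≤ ∑ i ∈ S, X i ω} ∪ {ω | Real.sqrt E ≤ ∑ i ∈ S, (-X i) ω} := by
    intro ω hω
    have h3 : Real.sqrt E ≤ |∑ i ∈ S, X i ω| := by
      rw [← Real.sqrt_sq_eq_abs, hsum]
      exact Real.sqrt_le_sqrt (le_of_lt hω)
    rcases le_abs.1 h3 with h | h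
    · exact Or.inl h
    · refine Or.inr ?_
      simpa [Finset.sum_neg_distrib] using h
  calc μ.real _ ≤ μ.real ({ω | Real.sqrt E ≤ ∑ i ∈ S, X i ω} ∪
        {ω | Real.sqrt E ≤ ∑ i ∈ S, (-X i) ω}) := measureReal_mono hsubset
    _ ≤ _ := measureReal_union_le _ _
    _ ≤ 2 * (n : ℝ) ^ (-c) := by linarith

/-- A union bound over the at most `n²` intervals `(s, t] ⊆ (0, n]`. -/
theorem Model.exists_noise_event (hM : Model μ n K Y f η σ κ Δ) (hn : 3 ≤ n)
    {c : ℝ} (hc : 0 < c) :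
    ∃ A : Set Ω, MeasurableSet A ∧ 1 - Real.exp 1 * (n : ℝ) ^ (3 - c) ≤ μ.real A ∧
      ∀ ω ∈ A, ∀ s t, s < t → t ≤ n →
        (∑ i ∈ Finset.Ioc s t, (Y i ω - f i)) ^ 2 ≤
          56 * c * σ ^ 2 * Real.log n * ((t : ℝ) - s) := by
  have hn0 : (0 : ℝ) < n := by exact_mod_cast (show 0 < n by omega)
  have hn1 : (1 : ℝ) ≤ n := by exact_mod_cast (show 1 ≤ n by omega)
  let P : Finset (ℕ × ℕ) := (Finset.range n ×ˢ Finset.Icc 1 n).filter fun p => p.1 < p.2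
  let B : ℕ × ℕ → Set Ω := fun p => {ω | 56 * c * σ ^ 2 * Real.log n * ((p.2 : ℝ) - p.1) <
    (∑ i ∈ Finset.Ioc p.1 p.2, (Y i ω - f i)) ^ 2}
  have hP : ∀ p ∈ P, p.1 < p.2 ∧ p.2 ≤ n := by
    intro p hp
    simp only [P, Finset.mem_filter, Finset.mem_product, Finset.mem_Icc] at hp
    exact ⟨hp.2, hp.1.2.2⟩
  have hPcard : (P.card : ℝ) ≤ (n : ℝ) ^ 2 := by
    have h1 : P.card ≤ n * n := (Finset.card_filter_le _ _).trans (by simp)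
    have h2 : (P.card : ℝ) ≤ (n * n : ℕ) := by exact_mod_cast h1
    rw [sq]
    exact_mod_cast h2
  have hBm : ∀ p ∈ P, MeasurableSet (B p) := by
    intro p hp
    refine measurableSet_lt measurable_const (Measurable.pow_const ?_ 2)
    refine Finset.measurable_sum _ fun i hi => (hM.measurable i ?_).sub_const _
    have := hP p hp
    simp only [Finset.mem_Ioc, Finset.mem_Icc] at *
    omega
  have hU : MeasurableSet (⋃ p ∈ P, B p) := Finset.measurableSet_biUnion P hBm
  have hbound : μ.real (⋃ p ∈ P, B p) ≤ Real.exp 1 * (n : ℝ) ^ (3 - c) := by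
    calc μ.real (⋃ p ∈ P, B p) ≤ ∑ p ∈ P, μ.real (B p) := measureReal_biUnion_finset_le _ _
      _ ≤ ∑ _p ∈ P, 2 * (n : ℝ) ^ (-c) := Finset.sum_le_sum fun p hp =>
          hM.measureReal_noise_sum_sq_gt_le hn hc (hP p hp).1 (hP p hp).2
      _ = P.card * (2 * (n : ℝ) ^ (-c)) := by rw [Finset.sum_const, nsmul_eq_mul]
      _ ≤ (n : ℝ) ^ 2 * (2 * (n : ℝ) ^ (-c)) := by gcongr
      _ ≤ (n : ℝ) ^ 3 * (Real.exp 1 * (n : ℝ) ^ (-c)) := by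
          have h2 : (2 : ℝ) ≤ Real.exp 1 := by
            have := Real.add_one_le_exp (1 : ℝ)
            linarith
          gcongr
          norm_num
      _ = Real.exp 1 * (n : ℝ) ^ (3 - c) := by
          rw [sub_eq_add_neg, Real.rpow_add hn0]
          norm_cast
          ring
  refine ⟨(⋃ p ∈ P, B p)ᶜ, hU.compl, ?_, ?_⟩
  · rw [probReal_compl_eq_one_sub hU]
    linarith
  · intro ω hω s t hst ht
    by_contra hcon
    refine hω (Set.mem_biUnion (x := (s, t)) ?_ (not_le.1 hcon))
    have : (s, t) ∈ P := by
      simp only [P, Finset.mem_filter, Finset.mem_product, Finset.mem_range, Finset.mem_Icc]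
      omega
    exact this

end Noise

/-! ### The Potts functional: minimizers and splicing -/

section Potts

variable {n : ℕ} {y : ℕ → ℝ} {lam : ℝ}

theorem mem_inducedChangePoints {u : ℕ → ℝ} {i : ℕ} :
    i ∈ inducedChangePoints n u ↔ (1 ≤ i ∧ i < n) ∧ u i ≠ u (i + 1) := by
  simp [inducedChangePoints]

theorem lowerSemicontinuous_pottsObjective (hlam : 0 ≤ lam) :
    LowerSemicontinuous (pottsObjective n y lam) := by
  have hcard : ∀ u : ℕ → ℝ, lam * ((inducedChangePoints n u).card : ℝ) =
      ∑ i ∈ Finset.Ico 1 n, Set.indicator {u : ℕ → ℝ | u i ≠ u (i + 1)} (fun _ => lam) u := by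
    intro u
    rw [inducedChangePoints, Finset.card_filter, Nat.cast_sum, Finset.mul_sum]
    refine Finset.sum_congr rfl fun i _ => ?_
    by_cases h : u i = u (i + 1) <;> simp [Set.indicator, h]
  have heq : pottsObjective n y lam = fun u => ∑ i ∈ Finset.Icc 1 n, (y i - u i) ^ 2 +
      ∑ i ∈ Finset.Ico 1 n, Set.indicator {u : ℕ → ℝ | u i ≠ u (i + 1)} (fun _ => lam) u := by
    funext u
    rw [pottsObjective, hcard]
  rw [heq]
  refine LowerSemicontinuous.add (Continuous.lowerSemicontinuous (by fun_prop)) ?_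
  refine lowerSemicontinuous_sum fun i _ => ?_
  refine IsOpen.lowerSemicontinuous_indicator ?_ hlam
  exact isOpen_ne_fun (continuous_apply i) (continuous_apply (i + 1))

/-- Clamping to a box that contains the data does not increase the functional, so a minimizer over
that box, which exists by compactness, is a global one. -/
theorem exists_isPottsEstimator (n : ℕ) (y : ℕ → ℝ) (hlam : 0 ≤ lam) :
    ∃ u, IsPottsEstimator n y lam u := by
  set M := ∑ i ∈ Finset.Icc 1 n, |y i| with hM
  have hyM : ∀ i ∈ Finset.Icc 1 n, |y i| ≤ M := fun i hi =>
    Finset.single_le_sum (f := fun i => |y i|) (fun _ _ => abs_nonneg _) hi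
  have hM0 : 0 ≤ M := Finset.sum_nonneg fun _ _ => abs_nonneg _
  have hne : (Set.univ.pi fun _ : ℕ => Set.Icc (-M) M).Nonempty :=
    ⟨fun _ => 0, fun _ _ => ⟨by simpa using hM0, hM0⟩⟩
  obtain ⟨u, -, hu⟩ := LowerSemicontinuousOn.exists_isMinOn hne
    (isCompact_univ_pi fun _ => isCompact_Icc)
    ((lowerSemicontinuous_pottsObjective (n := n) (y := y) hlam).lowerSemicontinuousOn _)
  refine ⟨u, fun v => ?_⟩
  let w : ℕ → ℝ := fun i => max (-M) (min M (v i))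
  have hw : w ∈ Set.univ.pi fun _ : ℕ => Set.Icc (-M) M := fun i _ =>
    ⟨le_max_left _ _, max_le (by linarith) (min_le_left _ _)⟩
  refine (hu hw).trans ?_
  unfold pottsObjective
  refine add_le_add (Finset.sum_le_sum fun i hi => ?_) (mul_le_mul_of_nonneg_left ?_ hlam)
  · have h1 := abs_le.1 (hyM i hi)
    simp only [w]
    rcases le_total M (v i) with h | h
    · rw [min_eq_left h, max_eq_right (by linarith)]
      nlinarith
    · rw [min_eq_right h]
      rcases le_total (-M) (v i) with h' | h'
      · rw [max_eq_right h']
      · rw [max_eq_left h']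
        nlinarith
  · have : inducedChangePoints n w ⊆ inducedChangePoints n v := by
      intro i hi
      rw [mem_inducedChangePoints] at hi ⊢
      refine ⟨hi.1, fun h => hi.2 ?_⟩
      simp only [w, h]
    exact_mod_cast Finset.card_le_card this

/-- The change in residual sum of squares on `(a, b]` when the fit `u` is replaced by `g`. -/
def rssChange (y u g : ℕ → ℝ) (a b : ℕ) : ℝ :=
  ∑ i ∈ Finset.Ioc a b, ((y i - g i) ^ 2 - (y i - u i) ^ 2)

theorem rssChange_add {u g : ℕ → ℝ} {a b c : ℕ} (hab : a ≤ b) (hbc : b ≤ c) :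
    rssChange y u g a b + rssChange y u g b c = rssChange y u g a c := by
  unfold rssChange
  rw [← Finset.Ioc_union_Ioc_eq_Ioc hab hbc,
    Finset.sum_union (Finset.Ioc_disjoint_Ioc_of_le le_rfl)]

/-- Basic inequality for a Potts estimator `u`: replacing `u` by `g` on `(a, b]` deletes the change
points of `u` inside `(a, b)` and creates new ones at most in `T`, which has to contain the jumps of
`g` and those endpoints `a ≠ 0`, `b ≠ n` that are not change points of `u` already. -/
theorem IsPottsEstimator.card_mul_le {u : ℕ → ℝ} (hu : IsPottsEstimator n y lam u) (hlam : 0 ≤ lam)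
    (g : ℕ → ℝ) {a b : ℕ} (hbn : b ≤ n) (T : Finset ℕ)
    (hg : ∀ i ∈ Finset.Ioo a b, g i ≠ g (i + 1) → i ∈ T)
    (ha : a ≠ 0 → a ∉ inducedChangePoints n u → a ∈ T)
    (hb : b ≠ n → b ∉ inducedChangePoints n u → b ∈ T) :
    lam * (((inducedChangePoints n u).filter (· ∈ Finset.Ioo a b)).card : ℝ) ≤
      lam * (T.card : ℝ) + rssChange y u g a b := by
  let v : ℕ → ℝ := fun i => if i ∈ Finset.Ioc a b then g i else u i
  have h1 := hu v
  unfold pottsObjective at h1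
  have hrss : ∑ i ∈ Finset.Icc 1 n, (y i - v i) ^ 2 =
      ∑ i ∈ Finset.Icc 1 n, (y i - u i) ^ 2 + rssChange y u g a b := by
    have hsub : Finset.Ioc a b ⊆ Finset.Icc 1 n := by
      intro i hi
      simp only [Finset.mem_Ioc, Finset.mem_Icc] at *
      omega
    have h2 : ∑ i ∈ Finset.Icc 1 n, ((y i - v i) ^ 2 - (y i - u i) ^ 2) = rssChange y u g a b := by
      rw [← Finset.sum_subset hsub]
      · exact Finset.sum_congr rfl fun i hi => by simp only [v, if_pos hi]
      · intro i _ hi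
        simp only [v, if_neg hi, sub_self]
    rw [Finset.sum_sub_distrib] at h2
    linarith
  have hcp : inducedChangePoints n v ⊆
      (inducedChangePoints n u).filter (· ∉ Finset.Ioo a b) ∪ T := by
    intro i hi
    rw [mem_inducedChangePoints] at hi
    obtain ⟨⟨hi1, hi2⟩, hne⟩ := hi
    rw [Finset.mem_union, Finset.mem_filter]
    by_cases hin : i ∈ Finset.Ioo a b
    · refine Or.inr (hg i hin ?_)
      rw [Finset.mem_Ioo] at hin
      have e1 : v i = g i := if_pos (by rw [Finset.mem_Ioc]; omega)
      have e2 : v (i + 1) = g (i + 1) := if_pos (by rw [Finset.mem_Ioc]; omega)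
      rwa [e1, e2] at hne
    · by_cases hJ : i ∈ inducedChangePoints n u
      · exact Or.inl ⟨hJ, hin⟩
      · refine Or.inr ?_
        by_cases hia : i = a
        · exact hia ▸ ha (by omega) (hia ▸ hJ)
        by_cases hib : i = b
        · exact hib ▸ hb (by omega) (hib ▸ hJ)
        exfalso
        apply hJ
        rw [mem_inducedChangePoints]
        rw [Finset.mem_Ioo] at hin
        have e1 : v i = u i := if_neg (by rw [Finset.mem_Ioc]; omega)
        have e2 : v (i + 1) = u (i + 1) := if_neg (by rw [Finset.mem_Ioc]; omega)
        rw [e1, e2] at hne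
        exact ⟨⟨hi1, hi2⟩, hne⟩
  have hcard : ((inducedChangePoints n v).card : ℝ) ≤
      ((inducedChangePoints n u).filter (· ∉ Finset.Ioo a b)).card + T.card := by
    exact_mod_cast (Finset.card_le_card hcp).trans (Finset.card_union_le _ _)
  have hsplit : (((inducedChangePoints n u).filter (· ∈ Finset.Ioo a b)).card : ℝ) +
      ((inducedChangePoints n u).filter (· ∉ Finset.Ioo a b)).card =
        (inducedChangePoints n u).card := by
    exact_mod_cast Finset.card_filter_add_card_filter_not _
  have h3 := mul_le_mul_of_nonneg_left hcard hlam
  rw [hrss, ← hsplit] at h1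
  linarith

end Potts

/-! ### Local error bounds for a Potts estimator -/

/-- The number of change points in `J` strictly between `s` and `t`. -/
def cpCount (J : Finset ℕ) (s t : ℕ) : ℕ := (J.filter (· ∈ Finset.Ioo s t)).card

theorem cpCount_mono (J : Finset ℕ) {s s' t t' : ℕ} (hs : s ≤ s') (ht : t' ≤ t) :
    cpCount J s' t' ≤ cpCount J s t :=
  Finset.card_le_card fun i hi => by
    simp only [Finset.mem_filter, Finset.mem_Ioo] at hi ⊢
    exact ⟨hi.1, by omega⟩

theorem cpCount_add_le (J : Finset ℕ) {s p t : ℕ} (hsp : s ≤ p) (hpt : p ≤ t) :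
    cpCount J s p + cpCount J p t ≤ cpCount J s t := by
  unfold cpCount
  rw [← Finset.card_union_of_disjoint]
  · refine Finset.card_le_card fun i => ?_
    simp only [Finset.mem_union, Finset.mem_filter, Finset.mem_Ioo]
    rintro (h | h) <;> exact ⟨h.1, by omega⟩
  · rw [Finset.disjoint_left]
    intro i
    simp only [Finset.mem_filter, Finset.mem_Ioo]
    omega

theorem cpCount_add_add_one_le {J : Finset ℕ} {s p t : ℕ} (hp : p ∈ J) (hsp : s < p) (hpt : p < t) :
    cpCount J s p + cpCount J p t + 1 ≤ cpCount J s t := by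
  unfold cpCount
  have hd : Disjoint (J.filter (· ∈ Finset.Ioo s p)) (J.filter (· ∈ Finset.Ioo p t)) := by
    rw [Finset.disjoint_left]
    intro i
    simp only [Finset.mem_filter, Finset.mem_Ioo]
    omega
  rw [← Finset.card_union_of_disjoint hd, ← Finset.card_insert_of_notMem (a := p)]
  · refine Finset.card_le_card fun i => ?_
    simp only [Finset.mem_insert, Finset.mem_union, Finset.mem_filter, Finset.mem_Ioo]
    rintro (rfl | h | h)
    · exact ⟨hp, hsp, hpt⟩
    · exact ⟨h.1, by omega⟩
    · exact ⟨h.1, by omega⟩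
  · simp only [Finset.mem_union, Finset.mem_filter, Finset.mem_Ioo]
    omega

theorem eq_of_forall_eq_succ {u : ℕ → ℝ} {s t : ℕ} (h : ∀ i ∈ Finset.Ioo s t, u i = u (i + 1)) :
    ∀ i ∈ Finset.Ioc s t, u i = u t := by
  induction t with
  | zero => intro i hi; simp at hi
  | succ t ih =>
    intro i hi
    rw [Finset.mem_Ioc] at hi
    rcases Nat.lt_or_ge t i with h1 | h1
    · rw [show i = t + 1 by omega]
    · rw [ih (fun j hj => h j (by rw [Finset.mem_Ioo] at *; omega)) i
        (by rw [Finset.mem_Ioc]; omega)]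
      exact h t (by rw [Finset.mem_Ioo]; omega)

theorem eq_of_forall_notMem {n : ℕ} {u : ℕ → ℝ} {s t : ℕ} (ht : t ≤ n)
    (h : ∀ p ∈ inducedChangePoints n u, ¬(s < p ∧ p < t)) : ∀ i ∈ Finset.Ioc s t, u i = u t := by
  refine eq_of_forall_eq_succ fun i hi => ?_
  by_contra hne
  rw [Finset.mem_Ioo] at hi
  exact h i (mem_inducedChangePoints.2 ⟨by omega, hne⟩) hi

/-- The step function with the value `φ` up to `e` and `φ'` after `e`. -/
def stepFun (φ φ' : ℝ) (e : ℕ) : ℕ → ℝ := fun i => if i ≤ e then φ else φ'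

theorem eq_of_stepFun_ne {φ φ' : ℝ} {e i : ℕ} (h : stepFun φ φ' e i ≠ stepFun φ φ' e (i + 1)) :
    i = e := by
  unfold stepFun at h
  by_contra hne
  split_ifs at h <;> first | exact h rfl | omega

/-- The partial sums of the noise `y - f` over the intervals `(s, t]` obey
`(∑ (y_i - f_i))² ≤ L (t - s)`. -/
def NoiseBound (n : ℕ) (y f : ℕ → ℝ) (L : ℝ) : Prop :=
  ∀ s t, s < t → t ≤ n → (∑ i ∈ Finset.Ioc s t, (y i - f i)) ^ 2 ≤ L * ((t : ℝ) - s)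

section Local

variable {n : ℕ} {y f u : ℕ → ℝ} {L : ℝ}

theorem rssChange_eq {s t : ℕ} (hst : s ≤ t) {g : ℕ → ℝ} {α φ φ' : ℝ}
    (hu : ∀ i ∈ Finset.Ioc s t, u i = α) (hf : ∀ i ∈ Finset.Ioc s t, f i = φ')
    (hg : ∀ i ∈ Finset.Ioc s t, g i = φ) :
    rssChange y u g s t = ((t : ℝ) - s) * ((φ' - φ) ^ 2 - (φ' - α) ^ 2) -
      2 * (∑ i ∈ Finset.Ioc s t, (y i - f i)) * (φ - α) := by
  have hcard : ((t : ℝ) - s) = (Finset.Ioc s t).card := by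
    rw [Nat.card_Ioc, Nat.cast_sub hst]
  rw [hcard, rssChange, Finset.mul_sum, Finset.sum_mul, ← nsmul_eq_mul, ← Finset.sum_const,
    ← Finset.sum_sub_distrib]
  refine Finset.sum_congr rfl fun i hi => ?_
  rw [hu i hi, hf i hi, hg i hi]
  ring

/-- Young's inequality with weight `w`, for the cross term between noise and bias. -/
theorem neg_two_mul_le {N m e L : ℝ} (hm : 0 < m) (h : N ^ 2 ≤ L * m) {w : ℝ} (hw : 0 < w) :
    -(2 * N * e) ≤ L / w + w * m * e ^ 2 := by
  have h1 : 0 ≤ (N + w * m * e) ^ 2 / (w * m) := by positivity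
  have h2 : (N + w * m * e) ^ 2 / (w * m) = N ^ 2 / (w * m) + 2 * N * e + w * m * e ^ 2 := by
    field_simp
    ring
  have h3 : N ^ 2 / (w * m) ≤ L / w := by
    rw [div_le_div_iff₀ (by positivity) hw]
    nlinarith
  linarith

/-- Refitting a piece of `u` by `φ` where the mean is `φ'`. -/
theorem NoiseBound.rssChange_le (hN : NoiseBound n y f L) {s t : ℕ} (hst : s < t) (ht : t ≤ n)
    {g : ℕ → ℝ} {α φ φ' : ℝ} (hu : ∀ i ∈ Finset.Ioc s t, u i = α)
    (hf : ∀ i ∈ Finset.Ioc s t, f i = φ') (hg : ∀ i ∈ Finset.Ioc s t, g i = φ) :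
    rssChange y u g s t ≤ 2 * ((t : ℝ) - s) * |φ' - φ| * |φ - α| + L := by
  have hm : (0 : ℝ) < (t : ℝ) - s := sub_pos.2 (by exact_mod_cast hst)
  rw [rssChange_eq hst.le hu hf hg]
  have h1 := neg_two_mul_le (e := φ - α) hm (hN s t hst ht) one_pos
  have h2 : -((φ' - φ) * (φ - α)) ≤ |φ' - φ| * |φ - α| := by
    rw [← abs_mul]; exact neg_le_abs _
  have h3 := mul_le_mul_of_nonneg_left h2 hm.le
  have h4 : ((t : ℝ) - s) * ((φ' - φ) ^ 2 - (φ' - α) ^ 2) =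
      2 * (((t : ℝ) - s) * -((φ' - φ) * (φ - α))) - ((t : ℝ) - s) * (φ - α) ^ 2 := by ring
  rw [h4]
  linarith

/-- Refitting a piece of `u` by the true mean `φ` gains half of the squared bias. -/
theorem NoiseBound.rssChange_le_of_eq (hN : NoiseBound n y f L) {s t : ℕ} (hst : s < t)
    (ht : t ≤ n) {g : ℕ → ℝ} {α φ : ℝ} (hu : ∀ i ∈ Finset.Ioc s t, u i = α)
    (hf : ∀ i ∈ Finset.Ioc s t, f i = φ) (hg : ∀ i ∈ Finset.Ioc s t, g i = φ) :
    rssChange y u g s t ≤ 2 * L - ((t : ℝ) - s) * (φ - α) ^ 2 / 2 := by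
  have hm : (0 : ℝ) < (t : ℝ) - s := sub_pos.2 (by exact_mod_cast hst)
  rw [rssChange_eq hst.le hu hf hg]
  have h1 := neg_two_mul_le (e := φ - α) hm (hN s t hst ht) (w := 1 / 2) (by norm_num)
  have h2 : L / (1 / 2) = 2 * L := by ring
  rw [h2] at h1
  rw [sub_self]
  linarith

/-- Refitting by the true mean costs at most `L` per piece of `u`. -/
theorem NoiseBound.rssChange_le_cpCount (hN : NoiseBound n y f L) (hL : 0 ≤ L) {s t : ℕ}
    (hst : s ≤ t) (ht : t ≤ n) {g : ℕ → ℝ} {φ : ℝ}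
    (hf : ∀ i ∈ Finset.Ioc s t, f i = φ) (hg : ∀ i ∈ Finset.Ioc s t, g i = φ) :
    rssChange y u g s t ≤ L * (1 + cpCount (inducedChangePoints n u) s t) := by
  induction hd : t - s using Nat.strong_induction_on generalizing s t with
  | _ d ih =>
    subst hd
    rcases hst.eq_or_lt with rfl | hlt
    · rw [rssChange, Finset.Ioc_self, Finset.sum_empty]
      positivity
    by_cases h : ∃ p ∈ inducedChangePoints n u, s < p ∧ p < t
    · obtain ⟨p, hp, hsp, hpt⟩ := h
      have h1 := ih (p - s) (by omega) hsp.le (by omega)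
        (fun i hi => hf i (by rw [Finset.mem_Ioc] at *; omega))
        (fun i hi => hg i (by rw [Finset.mem_Ioc] at *; omega)) rfl
      have h2 := ih (t - p) (by omega) hpt.le ht
        (fun i hi => hf i (by rw [Finset.mem_Ioc] at *; omega))
        (fun i hi => hg i (by rw [Finset.mem_Ioc] at *; omega)) rfl
      have h3 : ((cpCount (inducedChangePoints n u) s p : ℝ) +
          cpCount (inducedChangePoints n u) p t + 1) ≤ cpCount (inducedChangePoints n u) s t := by
        exact_mod_cast cpCount_add_add_one_le hp hsp hpt
      rw [← rssChange_add hsp.le hpt.le]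
      have h4 := mul_le_mul_of_nonneg_left h3 hL
      linarith
    · have hu := eq_of_forall_notMem (u := u) ht fun p hp hpp => h ⟨p, hp, hpp⟩
      have h1 := hN.rssChange_le hlt ht hu hf hg
      have h2 : 0 ≤ L * (cpCount (inducedChangePoints n u) s t : ℝ) := by positivity
      rw [sub_self, abs_zero] at h1
      linarith

/-- On a stretch where both the mean and the estimator are constant, their distance is of order
`√(L / length)`: otherwise refitting that stretch would pay for two new change points. -/
theorem IsPottsEstimator.mul_sq_le (hu : IsPottsEstimator n y (20 * L) u)
    (hN : NoiseBound n y f L) (hL : 0 < L) {s t : ℕ} (hst : s < t) (ht : t ≤ n)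
    {α φ : ℝ} (hα : ∀ i ∈ Finset.Ioc s t, u i = α) (hf : ∀ i ∈ Finset.Ioc s t, f i = φ) :
    ((t : ℝ) - s) * (φ - α) ^ 2 ≤ 84 * L := by
  have h1 := hu.card_mul_le (by linarith) (fun _ => φ) (a := s) ht {s, t} (fun i _ h => absurd rfl h)
    (fun _ _ => by simp) (fun _ _ => by simp)
  have h2 := hN.rssChange_le_of_eq hst ht (g := fun _ => φ) hα hf (fun _ _ => rfl)
  have h3 : (((({s, t} : Finset ℕ)).card : ℕ) : ℝ) ≤ 2 := by exact_mod_cast Finset.card_le_two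
  have h4 : 0 ≤ 20 * L * (((inducedChangePoints n u).filter (· ∈ Finset.Ioo s t)).card : ℝ) := by
    positivity
  nlinarith

/-- Extending the mean `φ` of a neighbouring segment across a short edge `(s, t]` with mean `φ'`
costs at most `2 L`, provided `u` takes the same value on the edge and on a long stretch `(x, z]`
of that segment: then `u` is so close to `φ` on the edge that little changes. -/
theorem IsPottsEstimator.rssChange_edge_le (hu : IsPottsEstimator n y (20 * L) u)
    (hN : NoiseBound n y f L) (hL : 0 < L) {s t x z : ℕ} (hst : s < t) (ht : t ≤ n) (hxz : x < z)
    (hz : z ≤ n) {g : ℕ → ℝ} {α φ φ' : ℝ} (hα : ∀ i ∈ Finset.Ioc s t, u i = α)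
    (hα' : ∀ i ∈ Finset.Ioc x z, u i = α) (hf : ∀ i ∈ Finset.Ioc x z, f i = φ)
    (hf' : ∀ i ∈ Finset.Ioc s t, f i = φ') (hg : ∀ i ∈ Finset.Ioc s t, g i = φ)
    (hshort : ((t : ℝ) - s) * |φ' - φ| ^ 2 ≤ 256 * L)
    (hlong : 25000000 * L ≤ ((z : ℝ) - x) * |φ' - φ| ^ 2) :
    rssChange y u g s t ≤ 2 * L := by
  have h1 := hN.rssChange_le hst ht hα hf' hg
  have h2 := hu.mul_sq_le hN hL hxz hz hα' hf
  have hm : (0 : ℝ) < (t : ℝ) - s := sub_pos.2 (by exact_mod_cast hst)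
  have hl : (0 : ℝ) < (z : ℝ) - x := sub_pos.2 (by exact_mod_cast hxz)
  set E := (t : ℝ) - s
  set m := (z : ℝ) - x
  set κ := |φ' - φ|
  have hκ : 0 ≤ κ := abs_nonneg _
  rw [← sq_abs] at h2
  set e := |φ - α|
  have he : 0 ≤ e := abs_nonneg _
  have h3 : (E * κ ^ 2) ^ 2 ≤ (256 * L) ^ 2 := by gcongr
  have h4 : 4 * (E * κ ^ 2) ^ 2 * (m * e ^ 2) ≤ 4 * (256 * L) ^ 2 * (84 * L) := by gcongr
  have h5 : (2 * E * κ * e) ^ 2 * (m * κ ^ 2) ≤ L ^ 2 * (m * κ ^ 2) := by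
    have h6 : L ^ 2 * (25000000 * L) ≤ L ^ 2 * (m * κ ^ 2) := by gcongr
    have h7 : (2 * E * κ * e) ^ 2 * (m * κ ^ 2) = 4 * (E * κ ^ 2) ^ 2 * (m * e ^ 2) := by ring
    have h8 : 0 < L ^ 3 := by positivity
    rw [h7]
    nlinarith
  have h9 : (2 * E * κ * e) ^ 2 ≤ L ^ 2 := le_of_mul_le_mul_right h5 (by linarith)
  have h10 : 2 * E * κ * e ≤ L := (le_abs_self _).trans (abs_le_of_sq_le_sq h9 hL.le)
  linarith

end Local

/-! ### Change points of a Potts estimator -/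

/-- A Potts estimator `u` with penalty `20 L` for data `y` whose noise is bounded at level `L`,
when every squared jump of the mean, times every segment length, is large compared with `L`. -/
structure StrongSignal (n K : ℕ) (y f u : ℕ → ℝ) (η : ℕ → ℕ) (L : ℝ) : Prop where
  L_pos : 0 < L
  noise : NoiseBound n y f L
  opt : IsPottsEstimator n y (20 * L) u
  eta_zero : η 0 = 0
  eta_last : η (K + 1) = n
  eta_lt : ∀ k ≤ K, η k < η (k + 1)
  mean_const : ∀ k ≤ K, ∀ i ∈ Finset.Ioc (η k) (η (k + 1)), f i = f (η (k + 1))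
  jump_pos : ∀ k ∈ Finset.Icc 1 K, 0 < jumpSize f η k
  jump_mul_le : ∀ k ∈ Finset.Icc 1 K, ∀ j ≤ K,
    100000000 * L ≤ jumpSize f η k ^ 2 * ((η (j + 1) : ℝ) - η j)

/-- The largest integer distance `r` with `r κ_k² ≤ C L`. -/
noncomputable def locRadius (f : ℕ → ℝ) (η : ℕ → ℕ) (L C : ℝ) (k : ℕ) : ℕ :=
  ⌊C * L / jumpSize f η k ^ 2⌋₊

namespace StrongSignal

variable {n K : ℕ} {y f u : ℕ → ℝ} {η : ℕ → ℕ} {L : ℝ}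

theorem locRadius_mul_le (h : StrongSignal n K y f u η L) {C : ℝ} (hC : 0 ≤ C) {k : ℕ}
    (hk : k ∈ Finset.Icc 1 K) : (locRadius f η L C k : ℝ) * jumpSize f η k ^ 2 ≤ C * L := by
  have hκ := pow_pos (h.jump_pos k hk) 2
  rw [← le_div_iff₀ hκ]
  exact Nat.floor_le (div_nonneg (mul_nonneg hC h.L_pos.le) hκ.le)

theorem lt_locRadius_add_one_mul (h : StrongSignal n K y f u η L) (C : ℝ) {k : ℕ}
    (hk : k ∈ Finset.Icc 1 K) :
    C * L < ((locRadius f η L C k : ℝ) + 1) * jumpSize f η k ^ 2 := by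
  rw [← div_lt_iff₀ (pow_pos (h.jump_pos k hk) 2)]
  exact Nat.lt_floor_add_one _

theorem four_mul_locRadius_le (h : StrongSignal n K y f u η L) {C : ℝ} (hC : 0 ≤ C)
    (hC' : C ≤ 25000000) {k j : ℕ} (hk : k ∈ Finset.Icc 1 K) (hj : j ≤ K) :
    4 * locRadius f η L C k + η j ≤ η (j + 1) := by
  have h1 := h.locRadius_mul_le hC hk
  have h2 := h.jump_mul_le k hk j hj
  have hκ := pow_pos (h.jump_pos k hk) 2
  have h3 : C * L ≤ 25000000 * L := mul_le_mul_of_nonneg_right hC' h.L_pos.le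
  have h4 : (4 * (locRadius f η L C k : ℝ)) * jumpSize f η k ^ 2 ≤
      ((η (j + 1) : ℝ) - η j) * jumpSize f η k ^ 2 := by linarith
  have h5 := le_of_mul_le_mul_right h4 hκ
  have h6 : 4 * (locRadius f η L C k : ℝ) + η j ≤ η (j + 1) := by linarith
  exact_mod_cast h6

theorem locRadius_le (h : StrongSignal n K y f u η L) {C C' : ℝ} (hC : C ≤ C') (k : ℕ) :
    locRadius f η L C k ≤ locRadius f η L C' k :=
  Nat.floor_le_floor (div_le_div_of_nonneg_right (mul_le_mul_of_nonneg_right hC h.L_pos.le)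
    (sq_nonneg _))

theorem eta_le (h : StrongSignal n K y f u η L) {k : ℕ} (hk : k ≤ K + 1) : η k ≤ n := by
  rw [← h.eta_last]
  induction hk using Nat.decreasingInduction with
  | self => exact le_rfl
  | of_succ j hj ih => exact (h.eta_lt j (by omega)).le.trans ih

theorem mean_const_left (h : StrongSignal n K y f u η L) {k : ℕ} (hk : k ≤ K) {i : ℕ}
    (hi : i ∈ Finset.Ioc (η k) (η (k + 1))) : f i = f (η k + 1) := by
  have := h.eta_lt k hk
  rw [h.mean_const k hk i hi, h.mean_const k hk (η k + 1) (by rw [Finset.mem_Ioc]; omega)]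

/-- Each true change point has an estimated one within distance `256 L / κ_k²`: otherwise, adding
at most three change points around it would decrease the functional. -/
theorem exists_near (h : StrongSignal n K y f u η L) {k : ℕ} (hk : k ∈ Finset.Icc 1 K) :
    ∃ p ∈ inducedChangePoints n u,
      η k ≤ p + locRadius f η L 256 k ∧ p ≤ η k + locRadius f η L 256 k := by
  by_contra hcon
  push Not at hcon
  obtain ⟨hk1, hkK⟩ := Finset.mem_Icc.1 hk
  obtain ⟨j, rfl⟩ : ∃ j, k = j + 1 := ⟨k - 1, by omega⟩
  have hL := h.L_pos
  have hgapl := h.four_mul_locRadius_le (C := 256) (by norm_num) (by norm_num) hk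
    (show j ≤ K by omega)
  have hgapr := h.four_mul_locRadius_le (C := 256) (by norm_num) (by norm_num) hk hkK
  have hltl := h.eta_lt j (by omega)
  have hltr := h.eta_lt (j + 1) hkK
  have hn := h.eta_le (show j + 1 + 1 ≤ K + 1 by omega)
  have hrad := h.lt_locRadius_add_one_mul 256 hk
  set e := η (j + 1) with he
  set r := locRadius f η L 256 (j + 1)
  set a := e - (r + 1) with ha
  set b := e + (r + 1) with hb
  have hae : a < e := by omega
  have heb : e < b := by omega
  have hconst := eq_of_forall_notMem (n := n) (u := u) (s := a) (t := b) (by omega)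
    fun p hp hpp => by have := hcon p hp (by omega); omega
  have hfl : ∀ i ∈ Finset.Ioc a e, f i = f e := fun i hi =>
    h.mean_const j (by omega) i (by rw [Finset.mem_Ioc] at *; omega)
  have hfr : ∀ i ∈ Finset.Ioc e b, f i = f (e + 1) := fun i hi =>
    h.mean_const_left hkK (by rw [Finset.mem_Ioc] at *; omega)
  have h1 := h.opt.card_mul_le (by linarith) (stepFun (f e) (f (e + 1)) e) (a := a) (b := b)
    (by omega) {a, e, b} (fun i _ hi => by simp [eq_of_stepFun_ne hi]) (fun _ _ => by simp)
    (fun _ _ => by simp)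
  have hT : (((({a, e, b} : Finset ℕ)).card : ℕ) : ℝ) ≤ 3 := by exact_mod_cast Finset.card_le_three
  have hl := h.noise.rssChange_le_of_eq hae (by omega) (g := stepFun (f e) (f (e + 1)) e)
    (fun i hi => hconst i (by rw [Finset.mem_Ioc] at *; omega)) hfl
    (fun i hi => if_pos (Finset.mem_Ioc.1 hi).2)
  have hr := h.noise.rssChange_le_of_eq heb (by omega) (g := stepFun (f e) (f (e + 1)) e)
    (fun i hi => hconst i (by rw [Finset.mem_Ioc] at *; omega)) hfr
    (fun i hi => if_neg (by rw [Finset.mem_Ioc] at hi; omega))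
  rw [← rssChange_add hae.le heb.le] at h1
  have hca : ((e : ℝ) - a) = r + 1 := by
    have : (e : ℝ) = a + (r + 1) := by exact_mod_cast (show e = a + (r + 1) by omega)
    linarith
  have hcb : ((b : ℝ) - e) = r + 1 := by
    rw [hb]; push_cast; ring
  rw [hca] at hl
  rw [hcb] at hr
  have hjump : jumpSize f η (j + 1) ^ 2 = (f (e + 1) - f e) ^ 2 := by
    rw [jumpSize, sq_abs]
  rw [hjump] at hrad
  have hsq : (f (e + 1) - f e) ^ 2 ≤ 2 * ((f e - u b) ^ 2 + (f (e + 1) - u b) ^ 2) := by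
    nlinarith [sq_nonneg ((f e - u b) + (f (e + 1) - u b))]
  have hmul := mul_le_mul_of_nonneg_left hsq (show (0 : ℝ) ≤ (r : ℝ) + 1 by positivity)
  have hnn : 0 ≤ 20 * L * (((inducedChangePoints n u).filter (· ∈ Finset.Ioo a b)).card : ℝ) := by
    positivity
  have hT' := mul_le_mul_of_nonneg_left hT (show (0 : ℝ) ≤ 20 * L by positivity)
  linarith

/-- `a` is the last estimated change point that is not far to the right of `η_k`, with `a = 0` for
`k = 0`. -/
def IsLastNear (n : ℕ) (f u : ℕ → ℝ) (η : ℕ → ℕ) (L : ℝ) (k a : ℕ) : Prop :=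
  (k = 0 ∧ a = 0) ∨ (1 ≤ k ∧ a ∈ inducedChangePoints n u ∧
    η k ≤ a + locRadius f η L 256 k ∧ a ≤ η k + locRadius f η L 25000000 k ∧
    ∀ p ∈ inducedChangePoints n u, p ≤ η k + locRadius f η L 25000000 k → p ≤ a)

/-- `b` is the first estimated change point that is not far to the left of `η_k`, with `b = n` for
`k = K + 1`. -/
def IsFirstNear (n K : ℕ) (f u : ℕ → ℝ) (η : ℕ → ℕ) (L : ℝ) (k b : ℕ) : Prop :=
  (k = K + 1 ∧ b = n) ∨ (k ≤ K ∧ b ∈ inducedChangePoints n u ∧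
    b ≤ η k + locRadius f η L 256 k ∧ η k ≤ b + locRadius f η L 25000000 k ∧
    ∀ p ∈ inducedChangePoints n u, η k ≤ p + locRadius f η L 25000000 k → b ≤ p)

theorem exists_isLastNear (h : StrongSignal n K y f u η L) {k : ℕ} (hk : k ≤ K) :
    ∃ a, IsLastNear n f u η L k a := by
  rcases Nat.eq_zero_or_pos k with rfl | hk1
  · exact ⟨0, Or.inl ⟨rfl, rfl⟩⟩
  obtain ⟨q, hq, hq1, hq2⟩ := h.exists_near (Finset.mem_Icc.2 ⟨hk1, hk⟩)
  have hr := h.locRadius_le (show (256 : ℝ) ≤ 25000000 by norm_num) k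
  let S := (inducedChangePoints n u).filter fun p => p ≤ η k + locRadius f η L 25000000 k
  have hqS : q ∈ S := Finset.mem_filter.2 ⟨hq, by omega⟩
  have hm := Finset.mem_filter.1 (S.max'_mem ⟨q, hqS⟩)
  have hle := S.le_max' q hqS
  exact ⟨S.max' ⟨q, hqS⟩, Or.inr ⟨hk1, hm.1, by omega, hm.2, fun p hp hpp =>
    S.le_max' p (Finset.mem_filter.2 ⟨hp, hpp⟩)⟩⟩

theorem exists_isFirstNear (h : StrongSignal n K y f u η L) {k : ℕ} (hk1 : 1 ≤ k)
    (hk : k ≤ K + 1) : ∃ b, IsFirstNear n K f u η L k b := by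
  rcases hk.eq_or_lt with rfl | hk
  · exact ⟨n, Or.inl ⟨rfl, rfl⟩⟩
  obtain ⟨q, hq, hq1, hq2⟩ := h.exists_near (Finset.mem_Icc.2 ⟨hk1, by omega⟩)
  have hr := h.locRadius_le (show (256 : ℝ) ≤ 25000000 by norm_num) k
  let S := (inducedChangePoints n u).filter fun p => η k ≤ p + locRadius f η L 25000000 k
  have hqS : q ∈ S := Finset.mem_filter.2 ⟨hq, by omega⟩
  have hm := Finset.mem_filter.1 (S.min'_mem ⟨q, hqS⟩)
  have hle := S.min'_le q hqS
  exact ⟨S.min' ⟨q, hqS⟩, Or.inr ⟨by omega, hm.1, by omega, hm.2, fun p hp hpp =>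
    S.min'_le p (Finset.mem_filter.2 ⟨hp, hpp⟩)⟩⟩

/-- Refitting `(a, η_{j+1}]` by the true mean of the segment `(η_j, η_{j+1}]` costs little even if
`a < η_j`: then `u` has no change point in a long stretch after `η_j`, and the edge `(a, η_j]` is
short. -/
theorem rssChange_left_le (h : StrongSignal n K y f u η L) {j a : ℕ} (hj : j ≤ K)
    (ha : IsLastNear n f u η L j a) (haj : a ≤ η (j + 1)) {g : ℕ → ℝ}
    (hg : ∀ i ∈ Finset.Ioc a (η (j + 1)), g i = f (η (j + 1))) :
    rssChange y u g a (η (j + 1)) ≤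
      L * (3 + cpCount (inducedChangePoints n u) a (η (j + 1))) := by
  have hL := h.L_pos
  have hn := h.eta_le (show j + 1 ≤ K + 1 by omega)
  rcases Nat.lt_or_ge a (η j) with hlt | hge
  · obtain ⟨hj0, -⟩ | ⟨hj1, haJ, ha1, ha2, hmax⟩ := ha
    · rw [hj0, h.eta_zero] at hlt
      omega
    obtain ⟨i, rfl⟩ : ∃ i, j = i + 1 := ⟨j - 1, by omega⟩
    have hk : i + 1 ∈ Finset.Icc 1 K := Finset.mem_Icc.2 ⟨hj1, hj⟩
    have hgl := h.four_mul_locRadius_le (C := 25000000) (by norm_num) le_rfl hk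
      (show i ≤ K by omega)
    have hgr := h.four_mul_locRadius_le (C := 25000000) (by norm_num) le_rfl hk hj
    have hrr := h.locRadius_le (show (256 : ℝ) ≤ 25000000 by norm_num) (i + 1)
    have hltl := h.eta_lt i (by omega)
    have hltr := h.eta_lt (i + 1) hj
    have hr := h.locRadius_mul_le (C := 256) (by norm_num) hk
    have hR := h.lt_locRadius_add_one_mul 25000000 hk
    set r := locRadius f η L 256 (i + 1)
    set R := locRadius f η L 25000000 (i + 1)
    have hfr : ∀ l ∈ Finset.Ioc (η (i + 1)) (η (i + 1 + 1)), f l = f (η (i + 1 + 1)) :=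
      h.mean_const (i + 1) hj
    have hjump : |f (η (i + 1)) - f (η (i + 1 + 1))| = jumpSize f η (i + 1) := by
      rw [jumpSize, abs_sub_comm, hfr (η (i + 1) + 1) (by rw [Finset.mem_Ioc]; omega)]
    -- beyond `a` there is no estimated change point up to the far side of the large window
    have hconst := eq_of_forall_notMem (n := n) (u := u) (s := a) (t := η (i + 1) + (R + 1)) (by omega)
      fun p hp hpp => by have := hmax p hp (by omega); omega
    have h1 := h.opt.rssChange_edge_le h.noise hL (s := a) (t := η (i + 1)) (x := η (i + 1))
      (z := η (i + 1) + (R + 1)) hlt (by omega) (by omega) (by omega) (g := g)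
      (fun l hl => hconst l (by rw [Finset.mem_Ioc] at *; omega))
      (fun l hl => hconst l (by rw [Finset.mem_Ioc] at *; omega))
      (fun l hl => hfr l (by rw [Finset.mem_Ioc] at *; omega))
      (fun l hl => h.mean_const i (by omega) l (by rw [Finset.mem_Ioc] at *; omega))
      (fun l hl => hg l (by rw [Finset.mem_Ioc] at *; omega))
      (by
        rw [hjump]
        have : (η (i + 1) : ℝ) ≤ a + r := by exact_mod_cast ha1
        refine le_trans ?_ hr
        gcongr
        linarith)
      (by
        rw [hjump]
        push_cast
        rw [add_sub_cancel_left]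
        exact hR.le)
    have h2 := h.noise.rssChange_le_cpCount (u := u) hL.le hltr.le hn hfr
      (fun l hl => hg l (by rw [Finset.mem_Ioc] at *; omega))
    have h3 : (cpCount (inducedChangePoints n u) (η (i + 1)) (η (i + 1 + 1)) : ℝ) ≤
        cpCount (inducedChangePoints n u) a (η (i + 1 + 1)) := by
      exact_mod_cast cpCount_mono _ hlt.le le_rfl
    rw [← rssChange_add hlt.le hltr.le]
    have h4 := mul_le_mul_of_nonneg_left h3 hL.le
    linarith
  · have h1 := h.noise.rssChange_le_cpCount (u := u) hL.le haj hn
      (fun l hl => h.mean_const j hj l (by rw [Finset.mem_Ioc] at *; omega)) hg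
    linarith

/-- The mirror image of `StrongSignal.rssChange_left_le`. -/
theorem rssChange_right_le (h : StrongSignal n K y f u η L) {j b : ℕ} (hj : j ≤ K)
    (hb : IsFirstNear n K f u η L (j + 1) b) (hbj : η j ≤ b) {g : ℕ → ℝ}
    (hg : ∀ i ∈ Finset.Ioc (η j) b, g i = f (η j + 1)) :
    rssChange y u g (η j) b ≤ L * (3 + cpCount (inducedChangePoints n u) (η j) b) := by
  have hL := h.L_pos
  have hn := h.eta_le (show j + 1 ≤ K + 1 by omega)
  rcases Nat.lt_or_ge (η (j + 1)) b with hlt | hge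
  · obtain ⟨hj0, hbn⟩ | ⟨hj1, hbJ, hb1, hb2, hmin⟩ := hb
    · rw [hj0, h.eta_last] at hlt
      omega
    have hk : j + 1 ∈ Finset.Icc 1 K := Finset.mem_Icc.2 ⟨by omega, hj1⟩
    have hgl := h.four_mul_locRadius_le (C := 25000000) (by norm_num) le_rfl hk hj
    have hgr := h.four_mul_locRadius_le (C := 25000000) (by norm_num) le_rfl hk hj1
    have hrr := h.locRadius_le (show (256 : ℝ) ≤ 25000000 by norm_num) (j + 1)
    have hn' := h.eta_le (show j + 1 + 1 ≤ K + 1 by omega)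
    have hltl := h.eta_lt j hj
    have hltr := h.eta_lt (j + 1) hj1
    have hr := h.locRadius_mul_le (C := 256) (by norm_num) hk
    have hR := h.lt_locRadius_add_one_mul 25000000 hk
    set r := locRadius f η L 256 (j + 1)
    set R := locRadius f η L 25000000 (j + 1)
    have hfl : ∀ l ∈ Finset.Ioc (η j) (η (j + 1)), f l = f (η j + 1) := fun l hl =>
      h.mean_const_left hj hl
    have hjump : |f (η (j + 1) + 1) - f (η j + 1)| = jumpSize f η (j + 1) := by
      rw [jumpSize, hfl (η (j + 1)) (by rw [Finset.mem_Ioc]; omega)]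
    have hconst := eq_of_forall_notMem (n := n) (u := u) (s := η (j + 1) - (R + 1)) (t := b) (by omega)
      fun p hp hpp => by have := hmin p hp (by omega); omega
    have hx : ((η (j + 1) : ℝ) - ((η (j + 1) - (R + 1) : ℕ) : ℝ)) = R + 1 := by
      rw [Nat.cast_sub (by omega)]
      push_cast
      ring
    have h1 := h.opt.rssChange_edge_le h.noise hL (s := η (j + 1)) (t := b)
      (x := η (j + 1) - (R + 1)) (z := η (j + 1)) hlt (by omega) (by omega) (by omega) (g := g)
      (fun l hl => hconst l (by rw [Finset.mem_Ioc] at *; omega))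
      (fun l hl => hconst l (by rw [Finset.mem_Ioc] at *; omega))
      (fun l hl => hfl l (by rw [Finset.mem_Ioc] at *; omega))
      (fun l hl => h.mean_const_left hj1 (by rw [Finset.mem_Ioc] at *; omega))
      (fun l hl => hg l (by rw [Finset.mem_Ioc] at *; omega))
      (by
        rw [hjump]
        have : (b : ℝ) ≤ η (j + 1) + r := by exact_mod_cast hb1
        refine le_trans ?_ hr
        gcongr
        linarith)
      (by
        rw [hjump, hx]
        exact hR.le)
    have h2 := h.noise.rssChange_le_cpCount (u := u) hL.le hltl.le hn hfl
      (fun l hl => hg l (by rw [Finset.mem_Ioc] at *; omega))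
    have h3 : (cpCount (inducedChangePoints n u) (η j) (η (j + 1)) : ℝ) ≤
        cpCount (inducedChangePoints n u) (η j) b := by
      exact_mod_cast cpCount_mono _ le_rfl hlt.le
    rw [← rssChange_add hltl.le hlt.le]
    have h4 := mul_le_mul_of_nonneg_left h3 hL.le
    linarith
  · have h1 := h.noise.rssChange_le_cpCount (u := u) hL.le hbj (hge.trans hn)
      (fun l hl => h.mean_const_left hj (by rw [Finset.mem_Ioc] at *; omega)) hg
    linarith

theorem isLastNear_lt (h : StrongSignal n K y f u η L) {j a : ℕ} (hj : j ≤ K)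
    (ha : IsLastNear n f u η L j a) : 2 * a < η j + η (j + 1) := by
  have hlt := h.eta_lt j hj
  obtain ⟨rfl, rfl⟩ | ⟨hj1, -, -, ha2, -⟩ := ha
  · omega
  · have := h.four_mul_locRadius_le (C := 25000000) (by norm_num) le_rfl
      (Finset.mem_Icc.2 ⟨hj1, hj⟩) hj
    omega

theorem lt_isFirstNear (h : StrongSignal n K y f u η L) {j b : ℕ} (hj : j ≤ K)
    (hb : IsFirstNear n K f u η L (j + 1) b) : η j + η (j + 1) < 2 * b := by
  have hlt := h.eta_lt j hj
  obtain ⟨hj1, rfl⟩ | ⟨hj1, -, -, hb2, -⟩ := hb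
  · have := h.eta_last
    rw [hj1] at hlt ⊢
    omega
  · have := h.four_mul_locRadius_le (C := 25000000) (by norm_num) le_rfl
      (Finset.mem_Icc.2 ⟨by omega, hj1⟩) hj
    omega

/-- Between the last estimated change point near `η_k` and the first one near `η_{k+2}` there is at
most one estimated change point: `η_{k+1}` alone would do as well as all of them, at a cost in
residual sum of squares below the penalty saved. -/
theorem cpCount_le_one (h : StrongSignal n K y f u η L) {k a b : ℕ} (hk : k + 1 ≤ K)
    (ha : IsLastNear n f u η L k a) (hb : IsFirstNear n K f u η L (k + 1 + 1) b) :
    cpCount (inducedChangePoints n u) a b ≤ 1 := by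
  have hL := h.L_pos
  have ha' := h.isLastNear_lt (by omega) ha
  have hb' := h.lt_isFirstNear hk hb
  have hlt1 := h.eta_lt k (by omega)
  have hlt2 := h.eta_lt (k + 1) hk
  have hbn : b ≤ n := by
    obtain ⟨-, rfl⟩ | ⟨-, hbJ, -⟩ := hb
    · exact le_rfl
    · exact (mem_inducedChangePoints.1 hbJ).1.2.le
  set e := η (k + 1) with he
  have h1 := h.opt.card_mul_le (by linarith) (stepFun (f e) (f (e + 1)) e) (a := a) hbn {e}
    (fun i _ hi => by simp [eq_of_stepFun_ne hi])
    (fun h0 hJ => by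
      obtain ⟨-, ha0⟩ | ⟨-, haJ, -⟩ := ha
      · exact absurd ha0 h0
      · exact absurd haJ hJ)
    (fun h0 hJ => by
      obtain ⟨-, hb0⟩ | ⟨-, hbJ, -⟩ := hb
      · exact absurd hb0 h0
      · exact absurd hbJ hJ)
  have hl := h.rssChange_left_le (by omega) ha (by omega) (g := stepFun (f e) (f (e + 1)) e)
    (fun i hi => if_pos (Finset.mem_Ioc.1 hi).2)
  have hr := h.rssChange_right_le hk hb (by omega) (g := stepFun (f e) (f (e + 1)) e)
    (fun i hi => if_neg (by rw [Finset.mem_Ioc] at hi; omega))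
  rw [← rssChange_add (show a ≤ e by omega) (show e ≤ b by omega), Finset.card_singleton] at h1
  change 20 * L * (cpCount (inducedChangePoints n u) a b : ℝ) ≤ _ at h1
  have hc : (cpCount (inducedChangePoints n u) a e : ℝ) +
      cpCount (inducedChangePoints n u) e b ≤ cpCount (inducedChangePoints n u) a b := by
    exact_mod_cast cpCount_add_le _ (show a ≤ e by omega) (show e ≤ b by omega)
  have hc' := mul_le_mul_of_nonneg_left hc hL.le
  push_cast at h1
  have h2 : L * (19 * (cpCount (inducedChangePoints n u) a b : ℝ)) ≤ L * 26 := by linarith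
  have h3 := le_of_mul_le_mul_left h2 hL
  have h4 : 19 * cpCount (inducedChangePoints n u) a b ≤ 26 := by exact_mod_cast h3
  omega

/-- Without a true change point, deleting all estimated ones costs less than the penalty. -/
theorem inducedChangePoints_eq_empty (h : StrongSignal n 0 y f u η L) :
    inducedChangePoints n u = ∅ := by
  have hL := h.L_pos
  have hmean := h.mean_const 0 le_rfl
  rw [h.eta_zero, h.eta_last] at hmean
  have h1 := h.opt.card_mul_le (by linarith) (fun _ => f n) (a := 0) le_rfl ∅
    (fun _ _ hi => absurd rfl hi) (fun h0 _ => absurd rfl h0) (fun h0 _ => absurd rfl h0)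
  have h2 := h.noise.rssChange_le_cpCount (u := u) hL.le (Nat.zero_le n) le_rfl
    (g := fun _ => f n) hmean (fun _ _ => rfl)
  change 20 * L * (cpCount (inducedChangePoints n u) 0 n : ℝ) ≤ _ at h1
  rw [Finset.card_empty, Nat.cast_zero, mul_zero, zero_add] at h1
  have h3 : L * (19 * (cpCount (inducedChangePoints n u) 0 n : ℝ)) ≤ L * 1 := by linarith
  have h4 := le_of_mul_le_mul_left h3 hL
  have h5 : 19 * cpCount (inducedChangePoints n u) 0 n ≤ 1 := by exact_mod_cast h4
  have h6 : cpCount (inducedChangePoints n u) 0 n = 0 := by omega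
  rw [cpCount, Finset.card_eq_zero, Finset.filter_eq_empty_iff] at h6
  refine Finset.eq_empty_of_forall_notMem fun p hp => h6 hp ?_
  have := (mem_inducedChangePoints.1 hp).1
  rw [Finset.mem_Ioo]
  omega

theorem exists_segment (h : StrongSignal n K y f u η L) {p : ℕ} (hp : 0 < p) (hpn : p ≤ n) :
    ∃ j ≤ K, η j < p ∧ p ≤ η (j + 1) := by
  have hex : ∃ j, p ≤ η (j + 1) := ⟨K, by rwa [h.eta_last]⟩
  classical
  refine ⟨Nat.find hex, Nat.find_min' hex (by rwa [h.eta_last]), ?_, Nat.find_spec hex⟩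
  rcases hj : Nat.find hex with _ | j
  · rwa [h.eta_zero]
  · exact not_le.1 (Nat.find_min hex (show j < Nat.find hex by omega))

/-- The estimated change points are in an order-preserving bijection with the true ones, and
matching points are within `256 L / κ_k²` of each other. -/
theorem exists_orderEmbOfFin (h : StrongSignal n K y f u η L) :
    ∃ hK : (inducedChangePoints n u).card = K, ∀ k : Fin K,
      |(((inducedChangePoints n u).orderEmbOfFin hK k : ℕ) : ℝ) - (η ((k : ℕ) + 1) : ℝ)| ≤
        256 * L / jumpSize f η ((k : ℕ) + 1) ^ 2 := by
  rcases Nat.eq_zero_or_pos K with rfl | hKpos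
  · exact ⟨by rw [h.inducedChangePoints_eq_empty, Finset.card_empty], fun k => k.elim0⟩
  have hex : ∀ k : Fin K, ∃ p ∈ inducedChangePoints n u,
      η ((k : ℕ) + 1) ≤ p + locRadius f η L 256 (k + 1) ∧
        p ≤ η ((k : ℕ) + 1) + locRadius f η L 256 (k + 1) := fun k =>
    h.exists_near (Finset.mem_Icc.2 ⟨by omega, k.2⟩)
  -- `q k` belongs to the true change point `η_{k+1}`, since `Fin K` starts at `0`
  choose q hqJ hq1 hq2 using hex
  have hqlo : ∀ k : Fin K, η k + η ((k : ℕ) + 1) < 2 * q k := fun k => by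
    have h1 := h.four_mul_locRadius_le (C := 256) (by norm_num) (by norm_num)
      (show (k : ℕ) + 1 ∈ Finset.Icc 1 K from Finset.mem_Icc.2 ⟨by omega, k.2⟩)
      (show (k : ℕ) ≤ K from k.2.le)
    have h2 := h.eta_lt k k.2.le
    have h3 := hq1 k
    omega
  have hqhi : ∀ k : Fin K, 2 * q k < η ((k : ℕ) + 1) + η ((k : ℕ) + 1 + 1) := fun k => by
    have h1 := h.four_mul_locRadius_le (C := 256) (by norm_num) (by norm_num)
      (show (k : ℕ) + 1 ∈ Finset.Icc 1 K from Finset.mem_Icc.2 ⟨by omega, k.2⟩)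
      (show (k : ℕ) + 1 ≤ K from k.2)
    have h2 := h.eta_lt (k + 1) k.2
    have h3 := hq2 k
    omega
  -- an estimated change point strictly between the neighbours of `q k` equals `q k`
  have huniq : ∀ (k : Fin K) (a b p : ℕ), IsLastNear n f u η L k a →
      IsFirstNear n K f u η L ((k : ℕ) + 1 + 1) b → p ∈ inducedChangePoints n u → a < p → p < b →
      p = q k := by
    intro k a b p ha hb hp hap hpb
    have ha' := h.isLastNear_lt k.2.le ha
    have hb' := h.lt_isFirstNear (show (k : ℕ) + 1 ≤ K from k.2) hb
    have h1 := hqlo k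
    have h2 := hqhi k
    refine Finset.card_le_one.1 (h.cpCount_le_one k.2 ha hb) p ?_ (q k) ?_
    · exact Finset.mem_filter.2 ⟨hp, Finset.mem_Ioo.2 ⟨hap, hpb⟩⟩
    · exact Finset.mem_filter.2 ⟨hqJ k, Finset.mem_Ioo.2 ⟨by omega, by omega⟩⟩
  have hsurj : ∀ p ∈ inducedChangePoints n u, ∃ k, q k = p := by
    intro p hp
    have hpr := (mem_inducedChangePoints.1 hp).1
    obtain ⟨j, hj, hjp, hpj⟩ := h.exists_segment (p := p) (by omega) (by omega)
    -- a point of the segment `(η_j, η_{j+1}]` belongs to `η_j`, unless it lies in the window of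
    -- `η_{j+1}`
    rcases Nat.eq_zero_or_pos j with rfl | hj1
    · obtain ⟨b, hb⟩ := h.exists_isFirstNear (show 1 ≤ 0 + 1 + 1 by omega) (by omega)
      have hb' := h.lt_isFirstNear (show 0 + 1 ≤ K by omega) hb
      have hlt := h.eta_lt (0 + 1) hKpos
      exact ⟨⟨0, hKpos⟩, (huniq ⟨0, hKpos⟩ 0 b p (Or.inl ⟨rfl, rfl⟩) hb hp (by omega)
        (by omega)).symm⟩
    · obtain ⟨i, rfl⟩ : ∃ i, j = i + 1 := ⟨j - 1, by omega⟩
      obtain ⟨b, hb⟩ := h.exists_isFirstNear (show 1 ≤ i + 1 + 1 by omega) (by omega)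
      rcases Nat.lt_or_ge p b with hpb | hbp
      · obtain ⟨a, ha⟩ := h.exists_isLastNear (show i ≤ K by omega)
        have ha' := h.isLastNear_lt (by omega) ha
        have hlt := h.eta_lt i (by omega)
        exact ⟨⟨i, hj⟩, (huniq ⟨i, hj⟩ a b p ha hb hp (by omega) hpb).symm⟩
      · have hjK : i + 1 + 1 ≤ K := by
          obtain ⟨-, rfl⟩ | ⟨hjK, -⟩ := hb
          · omega
          · exact hjK
        obtain ⟨a, ha⟩ := h.exists_isLastNear hj
        obtain ⟨b', hb'⟩ := h.exists_isFirstNear (show 1 ≤ i + 1 + 1 + 1 by omega) (by omega)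
        have h1 := h.isLastNear_lt hj ha
        have h2 := h.lt_isFirstNear hj hb
        have h3 := h.lt_isFirstNear hjK hb'
        have hlt := h.eta_lt _ hjK
        exact ⟨⟨i + 1, hjK⟩, (huniq ⟨i + 1, hjK⟩ a b' p ha hb' hp (by omega) (by omega)).symm⟩
  have hηmono : ∀ i j, i ≤ j → j ≤ K + 1 → η i ≤ η j := by
    intro i j hij
    induction hij with
    | refl => exact fun _ => le_rfl
    | step _ ih => exact fun hj => (ih (by omega)).trans (h.eta_lt _ (by omega)).le
  have hmono : StrictMono q := by
    intro k l hkl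
    have hkl' : (k : ℕ) + 1 ≤ l := hkl
    have h1 := hqhi k
    have h2 := hqlo l
    have h3 := hηmono (k + 1) l hkl' (by omega)
    have h4 := hηmono (k + 1 + 1) (l + 1) (by omega) (by omega)
    omega
  have himg : inducedChangePoints n u = Finset.univ.image q := by
    ext p
    simp only [Finset.mem_image, Finset.mem_univ, true_and]
    exact ⟨hsurj p, fun ⟨k, hk⟩ => hk ▸ hqJ k⟩
  have hcard : (inducedChangePoints n u).card = K := by
    rw [himg, Finset.card_image_of_injective _ hmono.injective, Finset.card_univ, Fintype.card_fin]
  refine ⟨hcard, fun k => ?_⟩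
  have hk : (k : ℕ) + 1 ∈ Finset.Icc 1 K := Finset.mem_Icc.2 ⟨by omega, k.2⟩
  rw [← Finset.orderEmbOfFin_unique hcard hqJ hmono, le_div_iff₀ (pow_pos (h.jump_pos _ hk) 2)]
  refine le_trans ?_ (h.locRadius_mul_le (by norm_num) hk)
  gcongr
  have h1 : (η ((k : ℕ) + 1) : ℝ) ≤ q k + locRadius f η L 256 (k + 1) := by exact_mod_cast hq1 k
  have h2 : (q k : ℝ) ≤ η ((k : ℕ) + 1) + locRadius f η L 256 (k + 1) := by exact_mod_cast hq2 k
  exact abs_le.2 ⟨by linarith, by linarith⟩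

end StrongSignal

/-! ### Consistency of the Potts estimator -/

theorem Model.strongSignal {Ω : Type*} [MeasurableSpace Ω] {μ : Measure Ω} {n K : ℕ}
    {Y : ℕ → Ω → ℝ} {f : ℕ → ℝ} {η : ℕ → ℕ} {σ κ Δ : ℝ} (hM : Model μ n K Y f η σ κ Δ)
    {y u : ℕ → ℝ} {L : ℝ} (hL : 0 < L) (hnoise : NoiseBound n y f L)
    (hu : IsPottsEstimator n y (20 * L) u) (hsnr : 100000000 * L ≤ κ ^ 2 * Δ) :
    StrongSignal n K y f u η L where
  L_pos := hL
  noise := hnoise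
  opt := hu
  eta_zero := hM.eta_zero
  eta_last := hM.eta_last
  eta_lt := hM.eta_lt
  mean_const := hM.mean_const
  jump_pos k hk := hM.jump_pos.trans_le (hM.jump_le k hk)
  jump_mul_le k hk j hj := by
    have h1 := hM.jump_le k hk
    have h2 := hM.spacing_le j hj
    have h3 := hM.jump_pos
    have h4 := hM.spacing_pos
    refine hsnr.trans ?_
    gcongr

/-- Since `log n ≥ 1`, the exponent `1 + ξ` of the signal-to-noise condition can be lowered
to `1`. -/
theorem mul_log_le_of_snr {n : ℕ} (hn : 3 ≤ n) {σ κ Δ ξ S : ℝ} (hσ : 0 < σ) (hΔ : 0 < Δ)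
    (hξ : 0 < ξ) (hS : 0 ≤ S)
    (h : κ * Real.sqrt Δ / σ ≥ Real.sqrt S * Real.sqrt (Real.log n ^ (1 + ξ))) :
    S * σ ^ 2 * Real.log n ≤ κ ^ 2 * Δ := by
  have hlog : 1 ≤ Real.log n := by
    rw [Real.le_log_iff_exp_le (by positivity)]
    have h3 : (3 : ℝ) ≤ n := by exact_mod_cast hn
    linarith [Real.exp_one_lt_d9]
  have hpow : Real.log n ≤ Real.log n ^ (1 + ξ) := by
    simpa using Real.rpow_le_rpow_of_exponent_le hlog (show (1 : ℝ) ≤ 1 + ξ by linarith)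
  have h1 := pow_le_pow_left₀ (by positivity) h 2
  rw [mul_pow, Real.sq_sqrt hS, Real.sq_sqrt (by positivity), div_pow, mul_pow,
    Real.sq_sqrt hΔ.le, le_div_iff₀ (by positivity)] at h1
  calc S * σ ^ 2 * Real.log n ≤ S * σ ^ 2 * Real.log n ^ (1 + ξ) := by gcongr
    _ = S * Real.log n ^ (1 + ξ) * σ ^ 2 := by ring
    _ ≤ κ ^ 2 * Δ := h1

end ChangePoint

theorem mainTheorem1 :
    ∀ c : ℝ, 3 < c →
      ∃ Clam : ℝ, 0 < Clam ∧ ∃ Csnr : ℝ, 0 < Csnr ∧ ∃ Ceps : ℝ, 0 < Ceps ∧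
        ∀ (Ω : Type*) [MeasurableSpace Ω] (μ : Measure Ω) [IsProbabilityMeasure μ]
          (n K : ℕ) (Y : ℕ → Ω → ℝ) (f : ℕ → ℝ) (η : ℕ → ℕ) (σ κ Δ ξ : ℝ),
          3 ≤ n →
          ChangePoint.Model μ n K Y f η σ κ Δ →
          0 < ξ →
          κ * Real.sqrt Δ / σ ≥ Csnr * Real.sqrt (Real.log n ^ (1 + ξ)) →
          ∃ A : Set Ω, MeasurableSet A ∧
            1 - Real.exp 1 * (n : ℝ) ^ (3 - c) ≤ μ.real A ∧
            ∀ ω ∈ A,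
              (∃ u : ℕ → ℝ,
                ChangePoint.IsPottsEstimator n (fun i => Y i ω) (Clam * σ ^ 2 * Real.log n) u) ∧
              ∀ u : ℕ → ℝ,
                ChangePoint.IsPottsEstimator n (fun i => Y i ω) (Clam * σ ^ 2 * Real.log n) u →
                ChangePoint.Localizes n K f η σ Ceps u := by
  intro c hc
  have hc0 : 0 < c := by linarith
  -- with `L = 56 c σ² log n`, the penalty is `20 L`, the signal strength `κ² Δ ≥ 10⁸ L`, and
  -- the localization bound `256 L / κ_k²`
  refine ⟨1120 * c, by positivity, Real.sqrt (5600000000 * c), by positivity, 14336 * c,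
    by positivity, ?_⟩
  intro Ω _ μ _ n K Y f η σ κ Δ ξ hn hM hξ hsnr
  obtain ⟨A, hAm, hAp, hA⟩ := hM.exists_noise_event hn hc0
  have hlog : 0 < Real.log n := Real.log_pos (by exact_mod_cast (show 1 < n by omega))
  have hσ := hM.sigma_pos
  have hL : 0 < 56 * c * σ ^ 2 * Real.log n := by positivity
  refine ⟨A, hAm, hAp, fun ω hω => ⟨ChangePoint.exists_isPottsEstimator _ _ (by positivity), ?_⟩⟩
  intro u hu
  have hs : ChangePoint.StrongSignal n K (fun i => Y i ω) f u η (56 * c * σ ^ 2 * Real.log n) := by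
    refine hM.strongSignal hL (hA ω hω) ?_ ?_
    · convert hu using 1
      ring
    · have := ChangePoint.mul_log_le_of_snr hn hσ hM.spacing_pos hξ (by positivity) hsnr
      linarith
  obtain ⟨hK, hloc⟩ := hs.exists_orderEmbOfFin
  refine ⟨hK, fun k => (hloc k).trans (le_of_eq ?_)⟩
  ring
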